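/- Let $M$ be a $3\times 3$ integer matrix that is expanding (each of its complex eigenvalues has modulus greater than $1$) and whose characteristic polynomial is $x^3+Ax^2+Bx+C$ with integers $1\le A\le B<C$. Let $v\in\mathbb{Z}^3\setminus\{0\}$ and let $\mathcal{D}=\{0,v,2v,\ldots,(|\det M|-1)v\}$ be a collinear digit set. Let $T=T(M,\mathcal{D})\subset\mathbb{R}^3$ be the unique nonempty compact set satisfying $MT=T+\mathcal{D}$, and assume that $T$ is a self-affine tile, i.e., that $T$ has positive Lebesgue measure. Let $\mathbb{Z}[M,\mathcal{D}]$ be the subgroup of $\mathbb{Z}^3$ generated by $\mathcal{D}\cup M\mathcal{D}\cup M^2\mathcal{D}$, and call the elements of \[ \mathcal{S}=\{\alpha\in\mathbb{Z}[M,\mathcal{D}]\setminus\{0\} :\; T\cap(T+\alpha)\neq\emptyset\} \] the neighbors of $T$. Then $T$ has exactly $14$ neighbors if and only if $A,B,C$ satisfy one of the following conditions: (1) $1\le A<B<C$, $B\ge 2A-1$, and $C\ge 2(B-A)+2$; (2) $1\le A<B<C$, $B<2A-1$, and $C\ge A+B-2$. -/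

import Mathlib

open scoped Pointwise Matrix

namespace SelfAffine

/-- An integer matrix is expanding if each of its (complex) eigenvalues is greater than `1`
in modulus. -/
def IsExpanding {m : ℕ} (M : Matrix (Fin m) (Fin m) ℤ) : Prop :=
  ∀ μ : ℂ, Module.End.HasEigenvalue (Matrix.toLin' (M.map (Int.cast : ℤ → ℂ))) μ → 1 < ‖μ‖

/-- The inclusion `ℤ^m → ℝ^m`. -/
def toReal {m : ℕ} (a : Fin m → ℤ) : Fin m → ℝ := fun i => (a i : ℝ)

/-- `T = T(M, D)` is a self-affine tile: `M` is an expanding integer matrix, `D` is a digit set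
of cardinality `|det M|`, and `T` is the nonempty compact subset of `ℝ^m` that satisfies the set
equation `M T = T + D`, and `T` has positive Lebesgue measure. -/
structure IsSelfAffineTile {m : ℕ} (M : Matrix (Fin m) (Fin m) ℤ) (D : Set (Fin m → ℤ))
    (T : Set (Fin m → ℝ)) : Prop where
  expanding : IsExpanding M
  card_digits : D.encard = (M.det.natAbs : ℕ∞)
  nonempty : T.Nonempty
  isCompact : IsCompact T
  set_equation : (fun x : Fin m → ℝ => M.map (Int.cast : ℤ → ℝ) *ᵥ x) '' T = T + toReal '' D
  volume_pos : 0 < MeasureTheory.volume T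

/-- `D = {0, v, 2v, …, (|det M| - 1) v}` for some nonzero `v ∈ ℤ^m`. -/
def IsCollinearDigitSet {m : ℕ} (M : Matrix (Fin m) (Fin m) ℤ) (D : Set (Fin m → ℤ)) : Prop :=
  ∃ v : Fin m → ℤ, v ≠ 0 ∧ D = {w | ∃ k : ℕ, k < M.det.natAbs ∧ w = k • v}

/-- The group `ℤ[M, D] = ℤ[D, M D, …, M^(m-1) D] ⊆ ℤ^m`. -/
def digitLattice {m : ℕ} (M : Matrix (Fin m) (Fin m) ℤ) (D : Set (Fin m → ℤ)) :
    AddSubgroup (Fin m → ℤ) :=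
  AddSubgroup.closure {w | ∃ i : ℕ, i < m ∧ ∃ d ∈ D, w = (M ^ i) *ᵥ d}

/-- The set of neighbors of `T`: the nonzero `a ∈ ℤ[M, D]` for which `T` meets `T + a`. -/
def neighbors {m : ℕ} (M : Matrix (Fin m) (Fin m) ℤ) (D : Set (Fin m → ℤ))
    (T : Set (Fin m → ℝ)) : Set (Fin m → ℤ) :=
  {a | a ∈ digitLattice M D ∧ a ≠ 0 ∧ (T ∩ (T + {toReal a})).Nonempty}

end SelfAffine

/-! Give lattice points coordinates in the basis `M²v + A Mv + B v`, `Mv + A v`, `v`. Multiplication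
by `M` then shifts the coordinates, up to a multiple of `v` that a difference of two digits can
absorb exactly when it is less than `C` in modulus. So a lattice point lies in `T - T` iff its
triple starts an infinite bounded walk for `Step`: `exists_step_of_mem` and `exists_bound` give one
direction, `mem_differences_of_finset` the other for walks inside a finite set.

Rewrite such a walk by its partial sums `t`. The recurrence becomes `|(C-B) t₁ + (B-A) t₂ + (A-1) t₃
+ t₄ - C t₀| < C`, whose weights are nonnegative with sum `C`. Thus `t₀` is within less than `1` of
a weighted average of its successors, and spread never grows backwards along a walk. The `14`
nonzero triples of spread at most `1` always start walks that stay among themselves or `0`, so they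
are always neighbors.

It remains to decide when larger spreads occur. Triples and walks decompose additively, which
reduces every spread to spread `2`. There the partial sums lie in `{-1, 0, 1}`, and under the stated
inequalities a finite check shows that long walks start with one-signed patterns, hence with spread
`1`. If the inequalities fail, an explicit cycle of spread `2` gives a further neighbor. -/

namespace SelfAffine

/-! ### Walks of integer triples -/

/-- `p → q` is a transition: `q` is the shift of `p` by one letter, and the linear recurrence with
characteristic polynomial `x ^ 3 + A x ^ 2 + B x + C` holds up to an error of at most `C - 1`. -/
def Step (A B C : ℤ) (p q : ℤ × ℤ × ℤ) : Prop :=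
  q.1 = p.2.1 ∧ q.2.1 = p.2.2 ∧ |q.2.2 + A * p.2.2 + B * p.2.1 + C * p.1| < C

/-- The partial sums of the triple `p`, including the empty one, lie in an interval of length `k`. -/
def SpreadLE (k : ℤ) (p : ℤ × ℤ × ℤ) : Prop :=
  ∃ m : ℤ, (m ≤ 0 ∧ 0 ≤ m + k) ∧ (m ≤ p.1 ∧ p.1 ≤ m + k) ∧
    (m ≤ p.1 + p.2.1 ∧ p.1 + p.2.1 ≤ m + k) ∧
    (m ≤ p.1 + p.2.1 + p.2.2 ∧ p.1 + p.2.1 + p.2.2 ≤ m + k)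

/-- There is a walk of `n` transitions from `p` to `q`. -/
def Walk (A B C : ℤ) : ℕ → ℤ × ℤ × ℤ → ℤ × ℤ × ℤ → Prop
  | 0, p, q => p = q
  | n + 1, p, q => ∃ r, Step A B C p r ∧ Walk A B C n r q

section Walks

variable {A B C : ℤ}

theorem Walk.split {m n : ℕ} {p r : ℤ × ℤ × ℤ} (h : Walk A B C (m + n) p r) :
    ∃ q, Walk A B C m p q ∧ Walk A B C n q r := by
  induction m generalizing p with
  | zero => exact ⟨p, rfl, by simpa using h⟩
  | succ m ih =>
    rw [Nat.succ_add_eq_add_succ, Nat.add_succ] at h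
    obtain ⟨s, hs, h⟩ := h
    obtain ⟨q, h₁, h₂⟩ := ih h
    exact ⟨q, ⟨s, hs, h₁⟩, h₂⟩

/-- If an integer `t₀` is within less than `1` of a convex combination of `t₁, …, t₄`, then it lies in
every integer interval that contains these. -/
theorem le_of_near_average (hA : 1 ≤ A) (hAB : A ≤ B) (hBC : B < C) {t₀ t₁ t₂ t₃ t₄ M : ℤ}
    (h : C * t₀ - ((C - B) * t₁ + (B - A) * t₂ + (A - 1) * t₃ + t₄) < C)
    (h₁ : t₁ ≤ M) (h₂ : t₂ ≤ M) (h₃ : t₃ ≤ M) (h₄ : t₄ ≤ M) : t₀ ≤ M := by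
  by_contra! h₀
  nlinarith [mul_nonneg (sub_nonneg.2 hBC.le) (sub_nonneg.2 h₁),
    mul_nonneg (sub_nonneg.2 hAB) (sub_nonneg.2 h₂), mul_nonneg (sub_nonneg.2 hA) (sub_nonneg.2 h₃),
    mul_le_mul_of_nonneg_left (Int.add_one_le_iff.2 h₀) (by lia : 0 ≤ C)]

/-- Summation by parts turns the recurrence in the differences `tᵢ₊₁ - tᵢ` into the weighted
average; the lower bound is the upper bound after a change of sign. -/
theorem mem_Icc_of_near_average (hA : 1 ≤ A) (hAB : A ≤ B) (hBC : B < C) {t₀ t₁ t₂ t₃ t₄ m k : ℤ}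
    (h : |(t₄ - t₃) + A * (t₃ - t₂) + B * (t₂ - t₁) + C * (t₁ - t₀)| < C)
    (h₁ : m ≤ t₁ ∧ t₁ ≤ m + k) (h₂ : m ≤ t₂ ∧ t₂ ≤ m + k) (h₃ : m ≤ t₃ ∧ t₃ ≤ m + k)
    (h₄ : m ≤ t₄ ∧ t₄ ≤ m + k) : m ≤ t₀ ∧ t₀ ≤ m + k := by
  rw [abs_lt] at h
  refine ⟨?_, le_of_near_average hA hAB hBC (t₁ := t₁) (t₂ := t₂) (t₃ := t₃) (t₄ := t₄)
    (by linarith) h₁.2 h₂.2 h₃.2 h₄.2⟩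
  have := le_of_near_average hA hAB hBC (t₀ := -t₀) (t₁ := -t₁) (t₂ := -t₂) (t₃ := -t₃) (t₄ := -t₄)
    (M := -m) (by linarith) (by linarith) (by linarith) (by linarith) (by linarith)
  linarith

theorem Step.spreadLE (hA : 1 ≤ A) (hAB : A ≤ B) (hBC : B < C) {p q : ℤ × ℤ × ℤ} {k : ℤ}
    (h : Step A B C p q) (hq : SpreadLE k q) : SpreadLE k p := by
  obtain ⟨x₀, x₁, x₂⟩ := p
  obtain ⟨_, _, x₃⟩ := q
  obtain ⟨rfl, rfl, h⟩ := h
  obtain ⟨m, h₁, h₂, h₃, h₄⟩ := hq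
  dsimp only at *
  -- Partial sums are counted from the start of `q`, so the start of `p` sits at `-x₀`; translating
  -- by `x₀` recentres the interval at `p`.
  have h₀ : m ≤ -x₀ ∧ -x₀ ≤ m + k :=
    mem_Icc_of_near_average hA hAB hBC (by convert h using 2; ring) h₁ h₂ h₃ h₄
  refine ⟨m + x₀, ?_⟩
  dsimp only
  lia

theorem Walk.spreadLE (hA : 1 ≤ A) (hAB : A ≤ B) (hBC : B < C) {n : ℕ} {p q : ℤ × ℤ × ℤ} {k : ℤ}
    (h : Walk A B C n p q) (hq : SpreadLE k q) : SpreadLE k p := by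
  induction n generalizing p with
  | zero => cases h; exact hq
  | succ n ih =>
    obtain ⟨r, hs, h⟩ := h
    exact hs.spreadLE hA hAB hBC (ih h)

theorem SpreadLE.add {k l : ℤ} {p q : ℤ × ℤ × ℤ} (hp : SpreadLE k p) (hq : SpreadLE l q) :
    SpreadLE (k + l) (p + q) := by
  obtain ⟨m, hp⟩ := hp
  obtain ⟨n, hq⟩ := hq
  refine ⟨m + n, ?_⟩
  simp only [Prod.fst_add, Prod.snd_add]
  lia

/-- A triple of spread at most `k + 1` is the sum of one of spread at most `1` and one of spread at
most `k`. -/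
theorem SpreadLE.exists_add {k : ℤ} {p : ℤ × ℤ × ℤ} (hk : 0 ≤ k) (hp : SpreadLE (k + 1) p) :
    ∃ r s, p = r + s ∧ SpreadLE 1 r ∧ SpreadLE k s := by
  obtain ⟨x, y, z⟩ := p
  obtain ⟨m, h₁, h₂, h₃, h₄⟩ := hp
  dsimp only at *
  -- `f` marks the partial sums equal to the top value `m + k + 1`; lowering these by `1` shortens
  -- the interval, and the differences of `f` form the summand of spread `1`.
  obtain ⟨f, hf⟩ : ∃ f : ℤ → ℤ, ∀ t, (f t = 1 ∧ m + k < t) ∨ (f t = 0 ∧ t ≤ m + k) :=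
    ⟨fun t => if m + k < t then 1 else 0, fun t => by dsimp only; split_ifs <;> lia⟩
  have f₁ := hf 0
  have f₂ := hf x
  have f₃ := hf (x + y)
  have f₄ := hf (x + y + z)
  refine ⟨(f x - f 0, f (x + y) - f x, f (x + y + z) - f (x + y)),
    (x - (f x - f 0), y - (f (x + y) - f x), z - (f (x + y + z) - f (x + y))), by simp,
    ⟨-f 0, ?_⟩, ⟨m + f 0, ?_⟩⟩ <;> dsimp only <;> lia

/-- A transition into a sum of two triples is the sum of two transitions. -/
theorem Step.exists_add {p r' s' : ℤ × ℤ × ℤ} (h : Step A B C p (r' + s')) :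
    ∃ r s, p = r + s ∧ Step A B C r r' ∧ Step A B C s s' := by
  obtain ⟨x₀, x₁, x₂⟩ := p
  obtain ⟨a₁, a₂, a₃⟩ := r'
  obtain ⟨b₁, b₂, b₃⟩ := s'
  obtain ⟨h₁, h₂, h⟩ := h
  simp only [Prod.mk_add_mk] at h₁ h₂ h
  subst h₁ h₂
  have hC : 0 < C := lt_of_le_of_lt (abs_nonneg _) h
  rw [abs_lt] at h
  obtain ⟨e, he⟩ : ∃ e, e = a₃ + b₃ + A * (a₂ + b₂) + B * (a₁ + b₁) + C * x₀ := ⟨_, rfl⟩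
  -- Both `d` and `d + e` lie in `[0, C)`. With `ρ` the remainder that goes with the quotient `y`,
  -- the two errors are `ρ - d` and `(d + e) - ρ`, each a difference of two numbers in `[0, C)`.
  obtain ⟨d, hd⟩ : ∃ d, d = max 0 (-e) := ⟨_, rfl⟩
  obtain ⟨y, hy⟩ : ∃ y, y = (d + (a₃ + A * a₂ + B * a₁)) / C := ⟨_, rfl⟩
  have e₁ := Int.emod_add_mul_ediv (d + (a₃ + A * a₂ + B * a₁)) C
  have e₂ := Int.emod_nonneg (d + (a₃ + A * a₂ + B * a₁)) hC.ne'
  have e₃ := Int.emod_lt_of_pos (d + (a₃ + A * a₂ + B * a₁)) hC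
  rw [← hy] at e₁
  rw [← he] at h
  have hd₀ : 0 ≤ d ∧ d < C ∧ 0 ≤ d + e ∧ d + e < C := by lia
  refine ⟨(-y, a₁, a₂), (x₀ + y, b₁, b₂), by simp, ⟨rfl, rfl, ?_⟩, ⟨rfl, rfl, ?_⟩⟩ <;>
    dsimp only <;> rw [abs_lt] <;> constructor <;> linarith

theorem Walk.exists_add {n : ℕ} {p r' s' : ℤ × ℤ × ℤ} (h : Walk A B C n p (r' + s')) :
    ∃ r s, p = r + s ∧ Walk A B C n r r' ∧ Walk A B C n s s' := by
  induction n generalizing p with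
  | zero => exact ⟨r', s', h, rfl, rfl⟩
  | succ n ih =>
    obtain ⟨q, hs, h⟩ := h
    obtain ⟨r, s, rfl, hr, hs'⟩ := ih h
    obtain ⟨r₁, s₁, rfl, hr₁, hs₁⟩ := hs.exists_add
    exact ⟨r₁, s₁, rfl, ⟨r, hr₁, hr⟩, ⟨s, hs₁, hs'⟩⟩

/-- If walks of length `L` that end with spread `2` start with spread `1`, then the same holds with
any final spread, for walks that are long enough. -/
theorem Walk.spreadLE_one (hA : 1 ≤ A) (hAB : A ≤ B) (hBC : B < C) {L : ℕ}
    (hL : ∀ p q, Walk A B C L p q → SpreadLE 2 q → SpreadLE 1 p) (k : ℕ) {p q : ℤ × ℤ × ℤ}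
    (h : Walk A B C (L * k) p q) (hq : SpreadLE (k + 1) q) : SpreadLE 1 p := by
  induction k generalizing p q with
  | zero => cases h; simpa using hq
  | succ k ih =>
    rw [Nat.mul_succ, add_comm] at h
    -- The last `L * k` steps bring both summands down to spread `1`, so `o` has spread `2` and the
    -- first `L` steps finish.
    obtain ⟨o, h₁, h₂⟩ := h.split
    push_cast at hq
    obtain ⟨r', s', rfl, hr', hs'⟩ := hq.exists_add (by positivity)
    obtain ⟨r, s, rfl, hr, hs⟩ := h₂.exists_add
    exact hL _ _ h₁ ((hr.spreadLE hA hAB hBC hr').add (ih hs hs'))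

theorem exists_walk {P : Set (ℤ × ℤ × ℤ)} (hP : ∀ p ∈ P, ∃ q ∈ P, Step A B C p q) (n : ℕ)
    {p : ℤ × ℤ × ℤ} (hp : p ∈ P) : ∃ q ∈ P, Walk A B C n p q := by
  induction n generalizing p with
  | zero => exact ⟨p, hp, rfl⟩
  | succ n ih =>
    obtain ⟨r, hr, hs⟩ := hP p hp
    obtain ⟨q, hq, h⟩ := ih hr
    exact ⟨q, hq, r, hs, h⟩

/-- A bounded set of triples in which every element has a successor consists of triples of spread at
most `1`, if this holds for the starting points of the long walks with spread `2`. -/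
theorem spreadLE_one_of_bounded (hA : 1 ≤ A) (hAB : A ≤ B) (hBC : B < C) {L : ℕ}
    (hL : ∀ p q, Walk A B C L p q → SpreadLE 2 q → SpreadLE 1 p) {P : Set (ℤ × ℤ × ℤ)}
    (hP : ∀ p ∈ P, ∃ q ∈ P, Step A B C p q) {K : ℕ}
    (hK : ∀ p ∈ P, |p.1| ≤ K ∧ |p.2.1| ≤ K ∧ |p.2.2| ≤ K) {p : ℤ × ℤ × ℤ} (hp : p ∈ P) :
    SpreadLE 1 p := by
  obtain ⟨q, hq, h⟩ := exists_walk hP (L * (6 * K)) hp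
  -- Entries bounded by `K` have partial sums in `[-3K, 3K]`, whence the factor `6 * K`.
  refine h.spreadLE_one hA hAB hBC hL _ ⟨-(3 * K), ?_⟩
  obtain ⟨h₁, h₂, h₃⟩ := hK q hq
  rw [abs_le] at h₁ h₂ h₃
  push_cast
  lia

/-! ### Walks of spread two -/

/-- The sign patterns `a, b, c, d` that can be continued `n` times, if `ok` tells which patterns can
follow a positive letter. -/
def alive (ok : ℤ → ℤ → ℤ → ℤ → Bool) : ℕ → ℤ → ℤ → ℤ → ℤ → Bool
  | 0, _, _, _, _ => true
  | n + 1, a, b, c, d => [-1, 0, 1].any fun e =>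
      (a == 0 || ok (a * b) (a * c) (a * d) (a * e)) && alive ok n b c d e

theorem alive_of_walk (hA : 1 ≤ A) (hAB : A ≤ B) (hBC : B < C) {ok : ℤ → ℤ → ℤ → ℤ → Bool}
    (hok : ∀ s₁ s₂ s₃ s₄ : ℤ, 0 < (C - B) * s₁ + (B - A) * s₂ + (A - 1) * s₃ + s₄ →
      ok s₁ s₂ s₃ s₄ = true) {n : ℕ} {p q : ℤ × ℤ × ℤ} (h : Walk A B C n p q)
    (hq : SpreadLE 2 q) :
    ∃ a b c d : ℤ, p = (b - a, c - b, d - c) ∧ a ∈ [-1, 0, 1] ∧ b ∈ [-1, 0, 1] ∧ c ∈ [-1, 0, 1] ∧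
      d ∈ [-1, 0, 1] ∧ alive ok n a b c d = true := by
  have key : ∀ t : ℤ, t ∈ [-1, 0, 1] ↔ -1 ≤ t ∧ t ≤ -1 + 2 := fun t => by simp; lia
  simp only [key]
  induction n generalizing p with
  | zero =>
    cases h
    obtain ⟨x, y, z⟩ := q
    obtain ⟨m, h₁, h₂, h₃, h₄⟩ := hq
    dsimp only at *
    -- The translation by `-1 - m` moves `[m, m + 2]` to `[-1, 1]`.
    refine ⟨-1 - m, -1 - m + x, -1 - m + x + y, -1 - m + x + y + z, ?_⟩
    simp only [Prod.mk.injEq, alive]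
    lia
  | succ n ih =>
    obtain ⟨r, hs, h⟩ := h
    obtain ⟨b, c, d, e, rfl, hb, hc, hd, he, hn⟩ := ih h
    obtain ⟨x₀, x₁, x₂⟩ := p
    obtain ⟨h₁, h₂, hs⟩ := hs
    dsimp only at *
    subst h₁ h₂
    obtain ⟨a, rfl⟩ : ∃ a, x₀ = b - a := ⟨b - x₀, by ring⟩
    have ha := mem_Icc_of_near_average hA hAB hBC hs hb hc hd he
    refine ⟨a, b, c, d, rfl, ha, hb, hc, hd, ?_⟩
    rw [alive, List.any_eq_true]
    refine ⟨e, (key e).2 he, ?_⟩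
    rw [Bool.and_eq_true, Bool.or_eq_true, beq_iff_eq]
    refine ⟨?_, hn⟩
    rw [abs_lt] at hs
    -- For `a = ±1` the error bound says that the weighted sum of `b, c, d, e` has the sign of `a`;
    -- for `a = 0` no constraint is kept.
    rcases (by lia : a = -1 ∨ a = 0 ∨ a = 1) with rfl | rfl | rfl
    · exact Or.inr (hok _ _ _ _ (by linarith))
    · exact Or.inl rfl
    · exact Or.inr (hok _ _ _ _ (by linarith))

theorem spreadLE_one_of_walk (hA : 1 ≤ A) (hAB : A ≤ B) (hBC : B < C)
    {ok : ℤ → ℤ → ℤ → ℤ → Bool}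
    (hok : ∀ s₁ s₂ s₃ s₄ : ℤ, 0 < (C - B) * s₁ + (B - A) * s₂ + (A - 1) * s₃ + s₄ →
      ok s₁ s₂ s₃ s₄ = true) {n : ℕ}
    (hn : ∀ a ∈ [-1, 0, 1], ∀ b ∈ [-1, 0, 1], ∀ c ∈ [-1, 0, 1], ∀ d ∈ [-1, 0, 1],
      alive ok n a b c d = true →
        (0 ≤ a ∧ 0 ≤ b ∧ 0 ≤ c ∧ 0 ≤ d) ∨ (a ≤ 0 ∧ b ≤ 0 ∧ c ≤ 0 ∧ d ≤ 0))
    (p q : ℤ × ℤ × ℤ) (h : Walk A B C n p q) (hq : SpreadLE 2 q) : SpreadLE 1 p := by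
  obtain ⟨a, b, c, d, rfl, ha, hb, hc, hd, h⟩ := alive_of_walk hA hAB hBC hok h hq
  have := hn a ha b hb c hc d hd h
  have key : ∀ t : ℤ, t ∈ [-1, 0, 1] ↔ -1 ≤ t ∧ t ≤ -1 + 2 := fun t => by simp; lia
  rw [key] at ha hb hc hd
  rcases this with h | h
  · refine ⟨-a, ?_⟩
    dsimp only
    lia
  · refine ⟨-1 - a, ?_⟩
    dsimp only
    lia

/-- The forms in `ok` are chosen so that the weighted sum is a nonnegative combination of them, so
one of them is positive whenever it is. For `A ≥ 2` the coefficients of `s₁`, `s₁ + s₂`, `s₂ + s₃`,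
`s₁ + s₂ + s₃ + s₄` are `C - 2(B - A) - 2`, `B - 2A + 1`, `A - 2`, `1`. For `A = 1` the form `2s₁ +
s₂ + s₄` replaces the last two. -/
theorem spreadLE_one_of_le (hA : 1 ≤ A) (hAB : A < B) (hBC : B < C) (h₁ : 2 * A - 1 ≤ B)
    (h₂ : 2 * (B - A) + 2 ≤ C) (p q : ℤ × ℤ × ℤ) (h : Walk A B C 8 p q) (hq : SpreadLE 2 q) :
    SpreadLE 1 p := by
  refine spreadLE_one_of_walk hA hAB.le hBC (ok := fun s₁ s₂ s₃ s₄ => decide (0 < s₁) ||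
    decide (0 < s₁ + s₂) || decide (0 < s₂ + s₃) || decide (0 < 2 * s₁ + s₂ + s₄) ||
    decide (0 < s₁ + s₂ + s₃ + s₄)) ?_ (by decide +kernel) p q h hq
  intro s₁ s₂ s₃ s₄ hs
  by_contra hno
  simp only [Bool.or_eq_true, decide_eq_true_eq, not_or, not_lt] at hno
  obtain ⟨⟨⟨⟨n₁, n₂⟩, n₃⟩, n₄⟩, n₅⟩ := hno
  have k₁ := mul_nonneg_of_nonpos_of_nonpos n₁ (by lia : 2 * (B - A) + 2 - C ≤ 0)
  by_cases hA' : A = 1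
  · subst hA'
    nlinarith [mul_nonneg_of_nonpos_of_nonpos n₂ (by lia : 2 - B ≤ 0)]
  · nlinarith [mul_nonneg_of_nonpos_of_nonpos n₂ (by lia : 2 * A - 1 - B ≤ 0),
      mul_nonneg_of_nonpos_of_nonpos n₃ (by lia : 2 - A ≤ 0)]

theorem spreadLE_one_of_lt (hA : 1 ≤ A) (hAB : A < B) (hBC : B < C) (h₁ : B < 2 * A - 1)
    (h₂ : A + B - 2 ≤ C) (p q : ℤ × ℤ × ℤ) (h : Walk A B C 8 p q) (hq : SpreadLE 2 q) :
    SpreadLE 1 p := by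
  -- On the boundary `C = A + B - 2` the weight of `s₁` is `A - 2`, one too small for the form `2s₁
  -- + s₂ + 2s₃ + s₄`; the form `s₁ + s₂ + 2s₃ + s₄` serves instead.
  rcases h₂.eq_or_lt with h₂ | h₂
  · refine spreadLE_one_of_walk hA hAB.le hBC (ok := fun s₁ s₂ s₃ s₄ => decide (0 < s₁ + s₃) ||
      decide (0 < s₁ + s₂ + s₃) || decide (0 < s₁ + s₂ + 2 * s₃ + s₄)) ?_
      (by decide +kernel) p q h hq
    intro s₁ s₂ s₃ s₄ hs
    by_contra hno
    simp only [Bool.or_eq_true, decide_eq_true_eq, not_or, not_lt] at hno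
    obtain ⟨⟨n₁, n₂⟩, n₃⟩ := hno
    subst h₂
    nlinarith [mul_nonneg_of_nonpos_of_nonpos n₁ (by lia : B - (2 * A - 2) ≤ 0),
      mul_nonneg_of_nonpos_of_nonpos n₂ (by lia : A + 1 - B ≤ 0)]
  · refine spreadLE_one_of_walk hA hAB.le hBC (ok := fun s₁ s₂ s₃ s₄ => decide (0 < s₁) ||
      decide (0 < s₁ + s₃) || decide (0 < s₁ + s₂ + s₃) || decide (0 < 2 * s₁ + s₂ + 2 * s₃ + s₄))
      ?_ (by decide +kernel) p q h hq
    intro s₁ s₂ s₃ s₄ hs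
    by_contra hno
    simp only [Bool.or_eq_true, decide_eq_true_eq, not_or, not_lt] at hno
    obtain ⟨⟨⟨n₁, n₂⟩, n₃⟩, n₄⟩ := hno
    nlinarith [mul_nonneg_of_nonpos_of_nonpos n₁ (by lia : A + B - 1 - C ≤ 0),
      mul_nonneg_of_nonpos_of_nonpos n₂ (by lia : B - (2 * A - 2) ≤ 0),
      mul_nonneg_of_nonpos_of_nonpos n₃ (by lia : A + 1 - B ≤ 0)]

end Walks

/-- The nonzero triples of spread at most `1`. -/
def spreadOneTriples : Finset (ℤ × ℤ × ℤ) :=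
  {(1, 0, 0), (0, 1, 0), (0, 0, 1), (1, -1, 0), (1, 0, -1), (0, 1, -1), (1, -1, 1),
    (-1, 0, 0), (0, -1, 0), (0, 0, -1), (-1, 1, 0), (-1, 0, 1), (0, -1, 1), (-1, 1, -1)}

/-- Up to translation these are the nonconstant 0-1 patterns of four partial sums: `2 ^ 4 - 2`. -/
theorem card_spreadOneTriples : spreadOneTriples.card = 14 := by
  decide

theorem mem_spreadOneTriples {p : ℤ × ℤ × ℤ} :
    p ∈ spreadOneTriples ↔ SpreadLE 1 p ∧ p ≠ 0 := by
  obtain ⟨x, y, z⟩ := p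
  simp only [spreadOneTriples, Finset.mem_insert, Finset.mem_singleton, Prod.mk.injEq, ne_eq,
    Prod.mk_eq_zero]
  constructor
  · intro h
    refine ⟨⟨-1 + max 0 (max x (max (x + y) (x + y + z))), ?_⟩, by omega⟩
    dsimp only
    rcases h with h | h | h | h | h | h | h | h | h | h | h | h | h | h <;>
      obtain ⟨rfl, rfl, rfl⟩ := h <;> decide
  · rintro ⟨⟨m, h₁, h₂, h₃, h₄⟩, h⟩
    dsimp only at *
    obtain ⟨a, rfl⟩ : ∃ a, y = a - x := ⟨x + y, by ring⟩
    obtain ⟨b, rfl⟩ : ∃ b, z = b - a := ⟨a + z, by ring⟩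
    have hb : m ≤ b ∧ b ≤ m + 1 := by lia
    have ha : m ≤ a ∧ a ≤ m + 1 := by lia
    clear h₃ h₄
    rcases (by lia : m = -1 ∨ m = 0) with rfl | rfl <;>
      obtain ⟨hx₁, hx₂⟩ := h₂ <;> obtain ⟨ha₁, ha₂⟩ := ha <;> obtain ⟨hb₁, hb₂⟩ := hb <;>
      interval_cases x <;> interval_cases a <;> interval_cases b <;> simp_all

/-! ### Walks that exist: the fourteen triples and the exceptional cycles -/

section Cycles

variable {A B C : ℤ}

theorem exists_step_of_spreadLE_one (hA : 1 ≤ A) (hAB : A ≤ B) (hBC : B < C) {p : ℤ × ℤ × ℤ}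
    (hp : SpreadLE 1 p) : ∃ q, SpreadLE 1 q ∧ Step A B C p q := by
  have key : ∀ z : ℤ, SpreadLE 1 (p.2.1, p.2.2, z) →
      |z + A * p.2.2 + B * p.2.1 + C * p.1| < C → ∃ q, SpreadLE 1 q ∧ Step A B C p q :=
    fun z hz h => ⟨_, hz, rfl, rfl, h⟩
  have spread : ∀ q : ℤ × ℤ × ℤ, q = 0 ∨ q ∈ spreadOneTriples → SpreadLE 1 q := by
    rintro q (rfl | hq)
    · exact ⟨0, by simp⟩
    · exact (mem_spreadOneTriples.1 hq).1
  by_cases h₀ : p = 0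
  · subst h₀
    exact key 0 (spread _ (by decide)) (by simp; lia)
  have hm := mem_spreadOneTriples.2 ⟨hp, h₀⟩
  simp only [spreadOneTriples, Finset.mem_insert, Finset.mem_singleton] at hm
  -- The new letter `0` works except for `±(1, 0, 0)`, where the error would be `±C`, and for `±(1,
  -- -1, 1)`, where this happens if `A = B`.
  rcases hm with rfl | rfl | rfl | rfl | rfl | rfl | rfl | rfl | rfl | rfl | rfl | rfl | rfl | rfl
  · exact key (-1) (spread _ (by decide)) (by rw [abs_lt]; constructor <;> dsimp only <;> lia)
  · exact key 0 (spread _ (by decide)) (by rw [abs_lt]; constructor <;> dsimp only <;> lia)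
  · exact key 0 (spread _ (by decide)) (by rw [abs_lt]; constructor <;> dsimp only <;> lia)
  · exact key 0 (spread _ (by decide)) (by rw [abs_lt]; constructor <;> dsimp only <;> lia)
  · exact key 0 (spread _ (by decide)) (by rw [abs_lt]; constructor <;> dsimp only <;> lia)
  · exact key 0 (spread _ (by decide)) (by rw [abs_lt]; constructor <;> dsimp only <;> lia)
  · exact key (-1) (spread _ (by decide)) (by rw [abs_lt]; constructor <;> dsimp only <;> lia)
  · exact key 1 (spread _ (by decide)) (by rw [abs_lt]; constructor <;> dsimp only <;> lia)
  · exact key 0 (spread _ (by decide)) (by rw [abs_lt]; constructor <;> dsimp only <;> lia)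
  · exact key 0 (spread _ (by decide)) (by rw [abs_lt]; constructor <;> dsimp only <;> lia)
  · exact key 0 (spread _ (by decide)) (by rw [abs_lt]; constructor <;> dsimp only <;> lia)
  · exact key 0 (spread _ (by decide)) (by rw [abs_lt]; constructor <;> dsimp only <;> lia)
  · exact key 0 (spread _ (by decide)) (by rw [abs_lt]; constructor <;> dsimp only <;> lia)
  · exact key 1 (spread _ (by decide)) (by rw [abs_lt]; constructor <;> dsimp only <;> lia)

/-- If the inequalities that characterize `14` neighbors fail, then there is a cycle of triples of
spread `2`. -/
theorem exists_cycle (hA : 1 ≤ A) (hAB : A ≤ B) (hBC : B < C)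
    (h : ¬(((1 ≤ A ∧ A < B ∧ B < C) ∧ 2 * A - 1 ≤ B ∧ 2 * (B - A) + 2 ≤ C) ∨
      ((1 ≤ A ∧ A < B ∧ B < C) ∧ B < 2 * A - 1 ∧ A + B - 2 ≤ C))) :
    ∃ P : Finset (ℤ × ℤ × ℤ), (∀ p ∈ P, ∃ q ∈ P, Step A B C p q) ∧
      ∃ p ∈ P, p ≠ 0 ∧ p ∉ spreadOneTriples := by
  -- The cycles come from the periodic letter sequences `-1, -1, 1, 1`, then `2, -2`, then `-1, -1,
  -- 2`.
  rcases (by lia : A = B ∨ C < 2 * (B - A) + 2 ∨ (B < 2 * A - 1 ∧ C < A + B - 2)) with h | h | h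
  · refine ⟨{(-1, -1, 1), (-1, 1, 1), (1, 1, -1), (1, -1, -1)}, ?_, (-1, -1, 1), by decide⟩
    simp only [Finset.mem_insert, Finset.mem_singleton, forall_eq_or_imp, forall_eq,
      exists_eq_or_imp, exists_eq_left, Step, abs_lt]
    lia
  · refine ⟨{(2, -2, 2), (-2, 2, -2)}, ?_, (2, -2, 2), by decide⟩
    simp only [Finset.mem_insert, Finset.mem_singleton, forall_eq_or_imp, forall_eq,
      exists_eq_or_imp, exists_eq_left, Step, abs_lt]
    lia
  · refine ⟨{(-1, -1, 2), (-1, 2, -1), (2, -1, -1)}, ?_, (-1, -1, 2), by decide⟩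
    simp only [Finset.mem_insert, Finset.mem_singleton, forall_eq_or_imp, forall_eq,
      exists_eq_or_imp, exists_eq_left, Step, abs_lt]
    lia

end Cycles

open Filter Topology

/-! ### Powers of the inverse of an expanding matrix -/

/-- By Gelfand's formula, `‖a ^ n‖` is eventually below `r ^ n` for some `r < 1`. -/
theorem tendsto_norm_pow_of_spectralRadius_lt_one {R : Type*} [NormedRing R] [NormedAlgebra ℂ R]
    [CompleteSpace R] {a : R} (ha : spectralRadius ℂ a < 1) :
    Tendsto (fun n : ℕ => ‖a ^ n‖) atTop (𝓝 0) := by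
  obtain ⟨r, har, hr⟩ := ENNReal.lt_iff_exists_nnreal_btwn.1 ha
  have hr' : r < 1 := by exact_mod_cast hr
  have h := (spectrum.pow_nnnorm_pow_one_div_tendsto_nhds_spectralRadius a).eventually_lt_const har
  refine squeeze_zero' (Eventually.of_forall fun n => norm_nonneg _) ?_
    (tendsto_pow_atTop_nhds_zero_of_lt_one r.coe_nonneg (by exact_mod_cast hr'))
  filter_upwards [h, eventually_gt_atTop 0] with n hn hn₀
  have hn₀' : (0 : ℝ) < n := by exact_mod_cast hn₀
  have h₁ := ENNReal.rpow_le_rpow hn.le hn₀'.le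
  rw [← ENNReal.rpow_mul, one_div, inv_mul_cancel₀ hn₀'.ne', ENNReal.rpow_one,
    ENNReal.rpow_natCast] at h₁
  exact_mod_cast h₁

theorem det_map_intCast {m : ℕ} (M : Matrix (Fin m) (Fin m) ℤ) (R : Type*) [CommRing R] :
    (M.map (Int.cast : ℤ → R)).det = (M.det : R) :=
  ((Int.castRingHom R).map_det M).symm

open scoped Matrix.Norms.Operator in
theorem IsExpanding.exists_norm_inv_pow_mulVec_lt {m : ℕ} [NeZero m] {M : Matrix (Fin m) (Fin m) ℤ}
    (hM : IsExpanding M) (hdet : M.det ≠ 0) (R : ℝ) {ε : ℝ} (hε : 0 < ε) :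
    ∃ n : ℕ, ∀ b : Fin m → ℝ, ‖b‖ ≤ R → ‖((M.map (Int.cast : ℤ → ℝ))⁻¹ ^ n) *ᵥ b‖ < ε := by
  have hc : IsUnit (M.map (Int.cast : ℤ → ℂ)) := by
    rw [Matrix.isUnit_iff_isUnit_det, isUnit_iff_ne_zero, det_map_intCast]
    exact_mod_cast hdet
  obtain ⟨u, hu⟩ := hc
  have hmap : (M.map (Int.cast : ℤ → ℝ)).map Complex.ofRealHom = M.map (Int.cast : ℤ → ℂ) := by
    ext i j
    simp
  have hdetR : (M.map (Int.cast : ℤ → ℝ)).det ≠ 0 := by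
    rw [det_map_intCast]
    exact_mod_cast hdet
  have hinv : Complex.ofRealHom.mapMatrix (M.map (Int.cast : ℤ → ℝ))⁻¹
      = ((u⁻¹ : (Matrix (Fin m) (Fin m) ℂ)ˣ) : Matrix (Fin m) (Fin m) ℂ) := by
    rw [eq_comm, Units.inv_eq_of_mul_eq_one_right]
    rw [hu, ← hmap, ← RingHom.mapMatrix_apply, ← map_mul, Matrix.mul_nonsing_inv _ hdetR.isUnit,
      map_one]
  have hrad : spectralRadius ℂ (Complex.ofRealHom.mapMatrix (M.map (Int.cast : ℤ → ℝ))⁻¹) < 1 := by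
    rw [hinv, ← ENNReal.coe_one]
    refine spectrum.spectralRadius_lt_of_forall_lt _ fun z hz => ?_
    have hz₀ : z ≠ 0 := by
      rintro rfl
      exact spectrum.zero_notMem ℂ (u⁻¹).isUnit hz
    have hz' : z⁻¹ ∈ spectrum ℂ (u : Matrix (Fin m) (Fin m) ℂ) := by
      have := (spectrum.inv_mem_iff (r := Units.mk0 z hz₀) (a := u⁻¹)).1 hz
      simpa using this
    rw [hu, ← Matrix.spectrum_toLin', ← Module.End.hasEigenvalue_iff_mem_spectrum] at hz'
    have h₁ := hM _ hz'
    rw [norm_inv] at h₁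
    have : ‖z‖ < 1 := (one_lt_inv_iff₀.1 h₁).2
    exact_mod_cast this
  -- The `ℓ^∞` operator norm depends only on the absolute values of the entries, so complexification
  -- preserves it.
  have hnorm : ∀ N : Matrix (Fin m) (Fin m) ℝ, ‖Complex.ofRealHom.mapMatrix N‖ = ‖N‖ := fun N => by
    simp [Matrix.linfty_opNorm_def]
  have hlim : Tendsto (fun n : ℕ => ‖(M.map (Int.cast : ℤ → ℝ))⁻¹ ^ n‖ * R) atTop (𝓝 (0 * R)) := by
    refine Tendsto.mul_const _ ((tendsto_norm_pow_of_spectralRadius_lt_one hrad).congr fun n => ?_)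
    rw [← map_pow, hnorm]
  rw [zero_mul] at hlim
  obtain ⟨n, hn⟩ := (hlim.eventually_lt_const hε).exists
  refine ⟨n, fun b hb => lt_of_le_of_lt ?_ hn⟩
  exact (Matrix.linfty_opNorm_mulVec _ _).trans (mul_le_mul_of_nonneg_left hb (norm_nonneg _))

/-- Inverse powers contract bounded sets uniformly to `0`, so `x` is a limit of points of `K`. This
replaces infinite digit expansions throughout. -/
theorem IsExpanding.mem_of_forall_sub_mem {m : ℕ} [NeZero m] {M : Matrix (Fin m) (Fin m) ℤ}
    (hM : IsExpanding M) (hdet : M.det ≠ 0) {K S : Set (Fin m → ℝ)} (hK : IsClosed K)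
    (hS : Bornology.IsBounded S) {x : Fin m → ℝ}
    (h : ∀ n : ℕ, ∃ b ∈ S, x - ((M.map (Int.cast : ℤ → ℝ))⁻¹ ^ n) *ᵥ b ∈ K) : x ∈ K := by
  obtain ⟨R, hR⟩ := hS.exists_norm_le
  rw [← hK.closure_eq, Metric.mem_closure_iff]
  intro ε hε
  obtain ⟨n, hn⟩ := hM.exists_norm_inv_pow_mulVec_lt hdet R hε
  obtain ⟨b, hb, hx⟩ := h n
  exact ⟨_, hx, by simpa [dist_eq_norm] using hn b (hR b hb)⟩

/-! ### Coordinates -/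

section Coord

variable {R : Type*} [CommRing R]

/-- The coordinates with respect to `M²v + A Mv + B v`, `Mv + A v`, `v`. -/
def coordMap (M : Matrix (Fin 3) (Fin 3) R) (A B : R) (v : Fin 3 → R) :
    R × R × R →ₗ[R] (Fin 3 → R) :=
  (LinearMap.fst R R (R × R)).smulRight (M *ᵥ M *ᵥ v + A • M *ᵥ v + B • v) +
    ((LinearMap.fst R R R ∘ₗ LinearMap.snd R R (R × R)).smulRight (M *ᵥ v + A • v) +
      (LinearMap.snd R R R ∘ₗ LinearMap.snd R R (R × R)).smulRight v)

theorem coordMap_apply (M : Matrix (Fin 3) (Fin 3) R) (A B : R) (v : Fin 3 → R) (p : R × R × R) :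
    coordMap M A B v p = p.1 • (M *ᵥ M *ᵥ v + A • M *ᵥ v + B • v) +
      (p.2.1 • (M *ᵥ v + A • v) + p.2.2 • v) :=
  rfl

theorem mulVec_coordMap {M : Matrix (Fin 3) (Fin 3) R} {A B C : R}
    (hM : M ^ 3 + A • M ^ 2 + B • M + C • (1 : Matrix (Fin 3) (Fin 3) R) = 0) (v : Fin 3 → R)
    (x₀ x₁ x₂ x₃ : R) :
    M *ᵥ coordMap M A B v (x₀, x₁, x₂) + (x₃ + A * x₂ + B * x₁ + C * x₀) • v =
      coordMap M A B v (x₁, x₂, x₃) := by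
  have h : M *ᵥ M *ᵥ M *ᵥ v + A • M *ᵥ M *ᵥ v + B • M *ᵥ v + C • v = 0 := by
    have := congrArg (· *ᵥ v) hM
    simpa [Matrix.add_mulVec, Matrix.smul_mulVec, pow_succ, Matrix.mulVec_mulVec, mul_assoc]
      using this
  simp only [coordMap_apply, Matrix.mulVec_add, Matrix.mulVec_smul]
  linear_combination (norm := module) x₀ • h

end Coord

theorem toReal_coordMap (M : Matrix (Fin 3) (Fin 3) ℤ) (A B : ℤ) (v : Fin 3 → ℤ) (p : ℤ × ℤ × ℤ) :
    toReal (coordMap M A B v p) =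
      coordMap (M.map (Int.cast : ℤ → ℝ)) A B (toReal v) (p.1, p.2.1, p.2.2) := by
  have hmul : ∀ w, M.map (Int.cast : ℤ → ℝ) *ᵥ toReal w = toReal (M *ᵥ w) := fun w => by
    ext i
    simp [toReal, Matrix.mulVec, dotProduct]
  simp only [coordMap_apply, hmul]
  ext i
  simp [toReal]

/-! ### Self-affine tiles with collinear digit set -/

theorem IsSelfAffineTile.exists_mulVec_eq {m : ℕ} {M : Matrix (Fin m) (Fin m) ℤ}
    {D : Set (Fin m → ℤ)} {T : Set (Fin m → ℝ)} (hT : IsSelfAffineTile M D T) {x : Fin m → ℝ}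
    (hx : x ∈ T) : ∃ y ∈ T, ∃ d ∈ D, M.map (Int.cast : ℤ → ℝ) *ᵥ x = y + toReal d := by
  have h := Set.mem_image_of_mem (fun x : Fin m → ℝ => M.map (Int.cast : ℤ → ℝ) *ᵥ x) hx
  rw [hT.set_equation] at h
  obtain ⟨y, hy, _, ⟨d, hd, rfl⟩, h⟩ := h
  exact ⟨y, hy, d, hd, h.symm⟩

theorem isUnit_det_map_intCast {m : ℕ} {M : Matrix (Fin m) (Fin m) ℤ} (hdet : M.det ≠ 0) :
    IsUnit (M.map (Int.cast : ℤ → ℝ)).det := by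
  rw [isUnit_iff_ne_zero, det_map_intCast]
  exact_mod_cast hdet

theorem inv_mulVec_eq {m : ℕ} {M : Matrix (Fin m) (Fin m) ℤ} (hdet : M.det ≠ 0) {x y : Fin m → ℝ}
    (h : M.map (Int.cast : ℤ → ℝ) *ᵥ x = y) : (M.map (Int.cast : ℤ → ℝ))⁻¹ *ᵥ y = x := by
  rw [← h, Matrix.mulVec_mulVec, Matrix.nonsing_inv_mul _ (isUnit_det_map_intCast hdet),
    Matrix.one_mulVec]

theorem IsSelfAffineTile.inv_mulVec_mem {m : ℕ} {M : Matrix (Fin m) (Fin m) ℤ}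
    {D : Set (Fin m → ℤ)} {T : Set (Fin m → ℝ)} (hT : IsSelfAffineTile M D T) (hdet : M.det ≠ 0)
    {y : Fin m → ℝ} (hy : y ∈ T) {d : Fin m → ℤ} (hd : d ∈ D) :
    (M.map (Int.cast : ℤ → ℝ))⁻¹ *ᵥ (y + toReal d) ∈ T := by
  have h : y + toReal d ∈ T + toReal '' D := Set.add_mem_add hy (Set.mem_image_of_mem _ hd)
  rw [← hT.set_equation] at h
  obtain ⟨x, hx, h⟩ := h
  rwa [inv_mulVec_eq hdet h]

theorem inter_add_singleton_nonempty_iff {G : Type*} [AddCommGroup G] {T : Set G} {a : G} :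
    (T ∩ (T + {a})).Nonempty ↔ a ∈ T - T := by
  constructor
  · rintro ⟨x, hx, y, hy, b, rfl, rfl⟩
    exact ⟨_, hx, y, hy, by simp⟩
  · rintro ⟨x, hx, y, hy, rfl⟩
    exact ⟨x, hx, y, hy, _, rfl, by simp⟩

theorem toReal_nsmul {m : ℕ} (k : ℕ) (v : Fin m → ℤ) : toReal (k • v) = (k : ℝ) • toReal v := by
  ext i
  simp [toReal]

section Charpoly

variable {M : Matrix (Fin 3) (Fin 3) ℤ} {A B C : ℤ}

theorem relation_of_charpoly (hchar : M.charpoly = Polynomial.X ^ 3 + Polynomial.C A *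
    Polynomial.X ^ 2 + Polynomial.C B * Polynomial.X + Polynomial.C C) :
    M ^ 3 + A • M ^ 2 + B • M + C • (1 : Matrix (Fin 3) (Fin 3) ℤ) = 0 := by
  have h := M.aeval_self_charpoly
  rw [hchar] at h
  simpa [Algebra.algebraMap_eq_smul_one] using h

theorem relation_map (h : M ^ 3 + A • M ^ 2 + B • M + C • (1 : Matrix (Fin 3) (Fin 3) ℤ) = 0) :
    M.map (Int.cast : ℤ → ℝ) ^ 3 + (A : ℝ) • M.map (Int.cast : ℤ → ℝ) ^ 2 +
      (B : ℝ) • M.map (Int.cast : ℤ → ℝ) + (C : ℝ) • (1 : Matrix (Fin 3) (Fin 3) ℝ) = 0 := by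
  have h' := congrArg (Int.castRingHom ℝ).mapMatrix h
  rw [map_add, map_add, map_add, map_zsmul, map_zsmul, map_zsmul, map_pow, map_pow, map_one,
    map_zero] at h'
  simp only [Int.cast_smul_eq_zsmul]
  exact h'

theorem det_of_charpoly (hchar : M.charpoly = Polynomial.X ^ 3 + Polynomial.C A *
    Polynomial.X ^ 2 + Polynomial.C B * Polynomial.X + Polynomial.C C) : M.det = -C := by
  rw [M.det_eq_sign_charpoly_coeff, hchar]
  simp [Odd.neg_one_pow (by decide : Odd 3)]

end Charpoly

/-- The data of the theorem: a self-affine tile with the digits `0, v, …, (C - 1) v`. -/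
structure CollinearTile (M : Matrix (Fin 3) (Fin 3) ℤ) (v : Fin 3 → ℤ) (D : Set (Fin 3 → ℤ))
    (T : Set (Fin 3 → ℝ)) (A B C : ℤ) : Prop extends IsSelfAffineTile M D T where
  two_le : 2 ≤ C
  relation : M ^ 3 + A • M ^ 2 + B • M + C • (1 : Matrix (Fin 3) (Fin 3) ℤ) = 0
  det_ne_zero : M.det ≠ 0
  digits : ∀ w, w ∈ D ↔ ∃ k : ℕ, (k : ℤ) < C ∧ w = k • v

/-! ### Neighbors as starting points of walks -/

namespace CollinearTile

variable {M : Matrix (Fin 3) (Fin 3) ℤ} {v : Fin 3 → ℤ} {D : Set (Fin 3 → ℤ)}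
  {T : Set (Fin 3 → ℝ)} {A B C : ℤ}

theorem inv_mulVec_mem_range (hT : CollinearTile M v D T A B C) {x : Fin 3 → ℝ}
    (hx : x ∈ LinearMap.range (coordMap (M.map (Int.cast : ℤ → ℝ)) A B (toReal v))) :
    (M.map (Int.cast : ℤ → ℝ))⁻¹ *ᵥ x ∈
      LinearMap.range (coordMap (M.map (Int.cast : ℤ → ℝ)) A B (toReal v)) := by
  obtain ⟨⟨x₀, x₁, x₂⟩, rfl⟩ := hx
  have hC : (C : ℝ) ≠ 0 := by
    have := hT.two_le
    exact_mod_cast (by lia : C ≠ 0)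
  -- Shifting backwards, the new leading coordinate is chosen over `ℝ` to make the multiple of `v`
  -- vanish.
  have h := mulVec_coordMap (relation_map hT.relation) (toReal v)
    (-(x₂ + A * x₁ + B * x₀) / C) x₀ x₁ x₂
  rw [mul_div_cancel₀ _ hC, add_neg_cancel, zero_smul, add_zero] at h
  rw [inv_mulVec_eq hT.det_ne_zero h]
  exact LinearMap.mem_range_self _ _

theorem toReal_mem_range (hT : CollinearTile M v D T A B C) {d : Fin 3 → ℤ} (hd : d ∈ D) :
    toReal d ∈ LinearMap.range (coordMap (M.map (Int.cast : ℤ → ℝ)) A B (toReal v)) := by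
  obtain ⟨k, -, rfl⟩ := (hT.digits d).1 hd
  exact ⟨(0, 0, (k : ℝ)), by rw [toReal_nsmul]; simp [coordMap_apply]⟩

theorem subset_range (hT : CollinearTile M v D T A B C) :
    T ⊆ LinearMap.range (coordMap (M.map (Int.cast : ℤ → ℝ)) A B (toReal v)) := by
  intro x hx
  refine hT.expanding.mem_of_forall_sub_mem hT.det_ne_zero (Submodule.closed_of_finiteDimensional _)
    hT.isCompact.isBounded fun n => ?_
  induction n with
  | zero => exact ⟨x, hx, by simp⟩
  | succ n ih =>
    obtain ⟨b, hb, h⟩ := ih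
    obtain ⟨y, hy, d, hd, hbd⟩ := hT.exists_mulVec_eq hb
    refine ⟨y, hy, ?_⟩
    have hpow : ∀ k : ℕ, (M.map (Int.cast : ℤ → ℝ))⁻¹ ^ k *ᵥ toReal d ∈
        LinearMap.range (coordMap (M.map (Int.cast : ℤ → ℝ)) A B (toReal v)) := fun k => by
      induction k with
      | zero => simpa using hT.toReal_mem_range hd
      | succ k ih =>
        rw [pow_succ', ← Matrix.mulVec_mulVec]
        exact hT.inv_mulVec_mem_range ih
    have hb' := inv_mulVec_eq hT.det_ne_zero hbd
    rw [← hb', Matrix.mulVec_mulVec, ← pow_succ, Matrix.mulVec_add, ← sub_sub] at h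
    simpa using add_mem h (hpow (n + 1))

/-- The range contains `T`, and a proper subspace has measure zero. Positive volume is what makes
the coordinates a basis. -/
theorem surjective_coordMap (hT : CollinearTile M v D T A B C) :
    Function.Surjective (coordMap (M.map (Int.cast : ℤ → ℝ)) A B (toReal v)) := by
  rw [← LinearMap.range_eq_top]
  by_contra h
  have h₀ := MeasureTheory.Measure.addHaar_submodule MeasureTheory.volume _ h
  exact hT.volume_pos.ne' (MeasureTheory.measure_mono_null hT.subset_range h₀)

theorem injective_coordMap_real (hT : CollinearTile M v D T A B C) :
    Function.Injective (coordMap (M.map (Int.cast : ℤ → ℝ)) A B (toReal v)) :=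
  (LinearMap.injective_iff_surjective_of_finrank_eq_finrank (by simp)).2 hT.surjective_coordMap

theorem injective_coordMap (hT : CollinearTile M v D T A B C) :
    Function.Injective (coordMap M A B v) := by
  intro p q h
  have h' := congrArg toReal h
  rw [toReal_coordMap, toReal_coordMap] at h'
  have := hT.injective_coordMap_real h'
  simp only [Prod.mk.injEq, Int.cast_inj] at this
  ext <;> tauto

/-- The coordinates of lattice points in `T - T`. -/
def differences (M : Matrix (Fin 3) (Fin 3) ℤ) (v : Fin 3 → ℤ) (T : Set (Fin 3 → ℝ)) (A B : ℤ) :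
    Set (ℤ × ℤ × ℤ) :=
  {p | toReal (coordMap M A B v p) ∈ T - T}

theorem isCompact_sub (hT : CollinearTile M v D T A B C) : IsCompact (T - T) := by
  rw [sub_eq_add_neg]
  exact IsCompact.add hT.isCompact (IsCompact.neg hT.isCompact)

theorem exists_bound (hT : CollinearTile M v D T A B C) :
    ∃ K : ℕ, ∀ p ∈ differences M v T A B, |p.1| ≤ K ∧ |p.2.1| ≤ K ∧ |p.2.2| ≤ K := by
  let e := (LinearEquiv.ofBijective _
    ⟨hT.injective_coordMap_real, hT.surjective_coordMap⟩).toContinuousLinearEquiv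
  have hc : IsCompact (e.symm '' (T - T)) :=
    hT.isCompact_sub.image e.symm.continuous
  obtain ⟨R, hR⟩ := hc.isBounded.exists_norm_le
  refine ⟨⌈R⌉₊, fun p hp => ?_⟩
  have h := hR _ (Set.mem_image_of_mem _ hp)
  rw [toReal_coordMap, show coordMap (M.map (Int.cast : ℤ → ℝ)) A B (toReal v)
    ((p.1 : ℝ), (p.2.1 : ℝ), (p.2.2 : ℝ)) = e (p.1, p.2.1, p.2.2) from rfl, e.symm_apply_apply] at h
  have key : ∀ x : ℤ, ‖(x : ℝ)‖ ≤ R → |x| ≤ (⌈R⌉₊ : ℤ) := fun x hx => by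
    rw [Real.norm_eq_abs] at hx
    exact_mod_cast hx.trans (Nat.le_ceil R)
  rw [Prod.norm_def, sup_le_iff, Prod.norm_def, sup_le_iff] at h
  exact ⟨key _ h.1, key _ h.2.1, key _ h.2.2⟩

theorem exists_step_of_mem (hT : CollinearTile M v D T A B C) {p : ℤ × ℤ × ℤ}
    (hp : p ∈ differences M v T A B) : ∃ q ∈ differences M v T A B, Step A B C p q := by
  obtain ⟨x₀, x₁, x₂⟩ := p
  obtain ⟨y, hy, z, hz, h⟩ := hp
  obtain ⟨y', hy', d, hd, hyd⟩ := hT.exists_mulVec_eq hy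
  obtain ⟨z', hz', d', hd', hzd⟩ := hT.exists_mulVec_eq hz
  obtain ⟨k, hk, rfl⟩ := (hT.digits d).1 hd
  obtain ⟨l, hl, rfl⟩ := (hT.digits d').1 hd'
  refine ⟨(x₁, x₂, l - k - A * x₂ - B * x₁ - C * x₀), ⟨y', hy', z', hz', ?_⟩, rfl, rfl, ?_⟩
  · have hm := mulVec_coordMap (relation_map hT.relation) (toReal v) x₀ x₁ x₂
      ((l - k - A * x₂ - B * x₁ - C * x₀ : ℤ) : ℝ)
    rw [toReal_coordMap] at h ⊢
    dsimp only at h ⊢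
    rw [← hm, ← h, Matrix.mulVec_sub, hyd, hzd, toReal_nsmul, toReal_nsmul]
    push_cast
    module
  · dsimp only
    rw [abs_lt]
    constructor <;> linarith

/-- Following a walk in `P` for `n` steps to `b` writes the starting point as an element of `T - T`
plus `M⁻ⁿ b`, with `b` in a finite set; `T - T` is closed. -/
theorem mem_differences_of_finset (hT : CollinearTile M v D T A B C) {P : Finset (ℤ × ℤ × ℤ)}
    (hP : ∀ p ∈ P, ∃ q ∈ P, Step A B C p q) {p : ℤ × ℤ × ℤ} (hp : p ∈ P) :
    p ∈ differences M v T A B := by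
  refine hT.expanding.mem_of_forall_sub_mem hT.det_ne_zero
    hT.isCompact_sub.isClosed
    ((P.finite_toSet.image fun p => toReal (coordMap M A B v p)).isBounded) fun n => ?_
  induction n generalizing p with
  | zero =>
    obtain ⟨t, ht⟩ := hT.nonempty
    exact ⟨_, ⟨p, hp, rfl⟩, t, ht, t, ht, by simp⟩
  | succ n ih =>
    obtain ⟨q, hq, hs⟩ := hP p hp
    obtain ⟨b, hb, y, hy, z, hz, hyz⟩ := ih hq
    refine ⟨b, hb, ?_⟩
    obtain ⟨x₀, x₁, x₂⟩ := p
    obtain ⟨y₁, y₂, x₃⟩ := q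
    obtain ⟨h₁, h₂, hs⟩ := hs
    dsimp only at h₁ h₂ hs hyz
    subst y₁ y₂
    have hm := mulVec_coordMap (relation_map hT.relation) (toReal v) x₀ x₁ x₂ x₃
    obtain ⟨e, he⟩ : ∃ e : ℤ, e = x₃ + A * x₂ + B * x₁ + C * x₀ := ⟨_, rfl⟩
    rw [← he, abs_lt] at hs
    have he' : (e : ℝ) = x₃ + A * x₂ + B * x₁ + C * x₀ := by exact_mod_cast he
    rw [← he'] at hm
    -- The negative and positive parts of `e` provide the two digits whose difference is `-e v`.
    have hk : (-e).toNat • v ∈ D := (hT.digits _).2 ⟨_, by lia, rfl⟩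
    have hl : e.toNat • v ∈ D := (hT.digits _).2 ⟨_, by lia, rfl⟩
    refine ⟨_, hT.inv_mulVec_mem hT.det_ne_zero hy hk, _,
      hT.inv_mulVec_mem hT.det_ne_zero hz hl, ?_⟩
    have hkl : (((-e).toNat : ℕ) : ℝ) - ((e.toNat : ℕ) : ℝ) = -e := by
      have : (((-e).toNat : ℕ) : ℤ) - ((e.toNat : ℕ) : ℤ) = -e := by lia
      exact_mod_cast this
    have hx := inv_mulVec_eq hT.det_ne_zero (rfl : _ = M.map (Int.cast : ℤ → ℝ) *ᵥ
      coordMap (M.map (Int.cast : ℤ → ℝ)) A B (toReal v) (x₀, x₁, x₂))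
    rw [toReal_coordMap] at hyz ⊢
    dsimp only at hyz ⊢
    rw [← Matrix.mulVec_sub, toReal_nsmul, toReal_nsmul, pow_succ', ← Matrix.mulVec_mulVec,
      ← hx, ← Matrix.mulVec_sub]
    congr 1
    rw [← hm] at hyz
    linear_combination (norm := module) hyz + hkl • toReal v

theorem mem_digitLattice_iff (hT : CollinearTile M v D T A B C) {a : Fin 3 → ℤ} :
    a ∈ digitLattice M D ↔ ∃ p, coordMap M A B v p = a := by
  constructor
  · intro h
    refine (AddSubgroup.closure_le (K := (LinearMap.range (coordMap M A B v)).toAddSubgroup)).2 ?_ h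
    rintro _ ⟨i, hi, d, hd, rfl⟩
    obtain ⟨k, -, rfl⟩ := (hT.digits d).1 hd
    rw [Matrix.mulVec_smul]
    refine nsmul_mem ?_ k
    interval_cases i
    · exact ⟨(0, 0, 1), by simp [coordMap_apply]⟩
    · refine ⟨(0, 1, -A), ?_⟩
      simp [coordMap_apply]
    -- The change of basis from `M²v, Mv, v` is unitriangular, hence invertible over `ℤ`.
    · refine ⟨(1, -A, A * A - B), ?_⟩
      simp only [coordMap_apply, pow_two, ← Matrix.mulVec_mulVec]
      module
  · rintro ⟨p, rfl⟩
    have hv : v ∈ D := (hT.digits v).2 ⟨1, by have := hT.two_le; lia, (one_smul _ _).symm⟩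
    have hmem : ∀ i < 3, M ^ i *ᵥ v ∈ digitLattice M D := fun i hi =>
      AddSubgroup.subset_closure ⟨i, hi, v, hv, rfl⟩
    have h₀ := hmem 0 (by norm_num)
    have h₁ := hmem 1 (by norm_num)
    have h₂ := hmem 2 (by norm_num)
    rw [pow_zero, Matrix.one_mulVec] at h₀
    rw [pow_one] at h₁
    rw [pow_two, ← Matrix.mulVec_mulVec] at h₂
    rw [coordMap_apply]
    exact add_mem (zsmul_mem (add_mem (add_mem h₂ (zsmul_mem h₁ A)) (zsmul_mem h₀ B)) _)
      (add_mem (zsmul_mem (add_mem h₁ (zsmul_mem h₀ A)) _) (zsmul_mem h₀ _))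

theorem neighbors_eq (hT : CollinearTile M v D T A B C) :
    neighbors M D T = coordMap M A B v '' (differences M v T A B \ {0}) := by
  ext a
  simp only [neighbors, inter_add_singleton_nonempty_iff, Set.mem_ofPred_eq,
    hT.mem_digitLattice_iff, Set.mem_image, Set.mem_sdiff, Set.mem_singleton_iff]
  constructor
  · rintro ⟨⟨p, rfl⟩, h₀, h⟩
    exact ⟨p, ⟨h, fun hp => h₀ (by rw [hp, map_zero])⟩, rfl⟩
  · rintro ⟨p, ⟨h, hp⟩, rfl⟩
    exact ⟨⟨p, rfl⟩, fun h₀ => hp (hT.injective_coordMap (h₀.trans (map_zero _).symm)), h⟩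

theorem encard_neighbors (hT : CollinearTile M v D T A B C) :
    (neighbors M D T).encard = (differences M v T A B \ {0}).encard := by
  rw [hT.neighbors_eq, hT.injective_coordMap.encard_image]

theorem spreadOneTriples_subset (hT : CollinearTile M v D T A B C) (hA : 1 ≤ A) (hAB : A ≤ B)
    (hBC : B < C) : (spreadOneTriples : Set (ℤ × ℤ × ℤ)) ⊆ differences M v T A B \ {0} := by
  have h0 : ∀ p, p ∈ insert 0 spreadOneTriples ↔ SpreadLE 1 p := fun p => by
    rw [Finset.mem_insert, mem_spreadOneTriples]
    by_cases hp : p = 0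
    · subst hp
      exact ⟨fun _ => ⟨0, by simp⟩, fun _ => Or.inl rfl⟩
    · simp [hp]
  intro p hp
  have hp' := mem_spreadOneTriples.1 hp
  refine ⟨hT.mem_differences_of_finset (P := insert 0 spreadOneTriples) (fun q hq => ?_)
    ((h0 p).2 hp'.1), hp'.2⟩
  obtain ⟨r, hr, hs⟩ := exists_step_of_spreadLE_one hA hAB hBC ((h0 q).1 hq)
  exact ⟨r, (h0 r).2 hr, hs⟩

end CollinearTile

end SelfAffine

/-! ### The count of neighbors -/

theorem theorem2 (M : Matrix (Fin 3) (Fin 3) ℤ) (D : Set (Fin 3 → ℤ)) (T : Set (Fin 3 → ℝ))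
    (hT : SelfAffine.IsSelfAffineTile M D T) (hD : SelfAffine.IsCollinearDigitSet M D)
    (A B C : ℤ)
    (hchar : M.charpoly = Polynomial.X ^ 3 + Polynomial.C A * Polynomial.X ^ 2
      + Polynomial.C B * Polynomial.X + Polynomial.C C)
    (hA : 1 ≤ A) (hAB : A ≤ B) (hBC : B < C) :
    (SelfAffine.neighbors M D T).encard = 14 ↔
      ((1 ≤ A ∧ A < B ∧ B < C) ∧ 2 * A - 1 ≤ B ∧ 2 * (B - A) + 2 ≤ C) ∨
      ((1 ≤ A ∧ A < B ∧ B < C) ∧ B < 2 * A - 1 ∧ A + B - 2 ≤ C) := by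
  obtain ⟨v, -, rfl⟩ := hD
  have hdet := SelfAffine.det_of_charpoly hchar
  have hT' : SelfAffine.CollinearTile M v _ T A B C :=
    { hT with
      two_le := by lia
      relation := SelfAffine.relation_of_charpoly hchar
      det_ne_zero := by lia
      digits := fun w => by
        have : ∀ k : ℕ, k < M.det.natAbs ↔ (k : ℤ) < C := fun k => by lia
        simp only [Set.mem_ofPred_eq, this] }
  have hsub := hT'.spreadOneTriples_subset hA hAB hBC
  have hcard : (SelfAffine.spreadOneTriples : Set (ℤ × ℤ × ℤ)).encard = 14 := by
    rw [Set.encard_coe_eq_coe_finsetCard, SelfAffine.card_spreadOneTriples]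
    rfl
  rw [hT'.encard_neighbors]
  constructor
  · intro h
    by_contra hno
    obtain ⟨P, hP, p, hp, hp₀, hp₁⟩ := SelfAffine.exists_cycle hA hAB hBC hno
    refine hp₁ ?_
    rw [← Finset.mem_coe, SelfAffine.spreadOneTriples.finite_toSet.eq_of_subset_of_encard_le hsub
      (h.trans hcard.symm).le]
    exact ⟨hT'.mem_differences_of_finset hP hp, hp₀⟩
  · intro h
    rw [← hcard]
    congr 1
    refine (Set.Subset.antisymm hsub fun p hp => ?_).symm
    obtain ⟨K, hK⟩ := hT'.exists_bound
    refine SelfAffine.mem_spreadOneTriples.2 ⟨SelfAffine.spreadLE_one_of_bounded hA hAB hBC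
      (L := 8) ?_ (fun _ => hT'.exists_step_of_mem) hK hp.1, hp.2⟩
    rcases h with ⟨⟨-, hlt, -⟩, h₁, h₂⟩ | ⟨⟨-, hlt, -⟩, h₁, h₂⟩
    · exact SelfAffine.spreadLE_one_of_le hA hlt hBC h₁ h₂
    · exact SelfAffine.spreadLE_one_of_lt hA hlt hBC h₁ h₂
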